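/- Let $\mathbf{k}$ be a field of characteristic $0$ and $\mathfrak{a}$ a $\mathbf{k}$-vector space. For $n\ge 1$ let $C_n=\{[1],\dots,[n]\}$ and $C^n_{\mathsf{pL}}(\mathfrak a,\mathfrak a)=\mathrm{Hom}(\mathbf{k}[C_n]\otimes\mathfrak a^{\otimes n},\mathfrak a)$. Let $\mathrm{Sh}(r,s)$ be the set of permutations $\sigma$ of $\{1,\dots,r+s\}$ with $\sigma(1)<\dots<\sigma(r)$ and $\sigma(r+1)<\dots<\sigma(r+s)$. For $m,n\ge 1$, $1\le i\le m$ and $\sigma\in \mathrm{Sh}(i-1,n-1)$, distribute the sequence $[\sigma(1)],\dots,[\sigma(i+n-2)],[i+n-1],\dots,[m+n-1]$, in this order, into $m$ boxes, the $i$-th box receiving $n$ entries and every other box one entry. Let $R^\sigma_{m;i,n}[r]=[k]$ if $[r]$ lies in the $k$-th box; let $S^\sigma_{m;i,n}[r]=[j]$ if $[r]$ is the $j$-th entry of the $i$-th box, and $S^\sigma_{m;i,n}[r]=[1]+\dots+[n]$ if $[r]$ is not in the $i$-th box. For $f\in C^m_{\mathsf{pL}}(\mathfrak a,\mathfrak a)$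 and $g\in C^n_{\mathsf{pL}}(\mathfrak a,\mathfrak a)$ define $f\diamond_i g\in C^{m+n-1}_{\mathsf{pL}}(\mathfrak a,\mathfrak a)$ by $$(f\diamond_i g)([r];x_1,\dots,x_{m+n-1})=\sum_{\sigma\in \mathrm{Sh}(i-1,n-1)}(-1)^\sigma f\big(R^\sigma_{m;i,n}[r];x_{\sigma(1)},\dots,x_{\sigma(i-1)},g(S^\sigma_{m;i,n}[r];x_{\sigma(i)},\dots,x_{\sigma(i+n-2)},x_{i+n-1}),x_{i+n},\dots,x_{m+n-1}\big)$$ and $$\llbracket f,g\rrbracket_{\mathsf{pL}}=\sum_{i=1}^m(-1)^{(i-1)(n-1)}f\diamond_i g-(-1)^{(m-1)(n-1)}\sum_{i=1}^n(-1)^{(i-1)(m-1)}g\diamond_i f .$$ Then: (i) $(C^{*}_{\mathsf{pL}}(\mathfrak a,\mathfrak a),\llbracket\cdot,\cdot\rrbracket_{\mathsf{pL}})$ is a degree $-1$ graded Lie algebra; that is, with $C^{p+1}_{\mathsf{pL}}(\mathfrak a,\mathfrak a)$ placed in degree $p$, the bilinear bracket is graded skew-symmetric and satisfies the graded Jacobi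 identity. (ii) Call a pair of bilinear operations $\triangleleft,\triangleright:\mathfrak a\otimes\mathfrak a\to\mathfrak a$ a pre-Leibniz structure on $\mathfrak a$ if, for all $x,y,z\in\mathfrak a$, $$x\triangleleft(y\triangleleft z+y\triangleright z)=(x\triangleleft y)\triangleleft z+y\triangleright(x\triangleleft z),$$ $$x\triangleright(y\triangleleft z)=(x\triangleright y)\triangleleft z+y\triangleleft(x\triangleleft z+x\triangleright z),$$ $$x\triangleright(y\triangleright z)=(x\triangleleft y+x\triangleright y)\triangleright z+y\triangleright(x\triangleright z).$$ Then $(\triangleleft,\triangleright)\mapsto\pi$, where $\pi([1];x,y)=x\triangleleft y$ and $\pi([2];x,y)=x\triangleright y$, is a bijection from the pre-Leibniz structures on $\mathfrak a$ onto the Maurer–Cartan elements of the graded Lie algebra in (i), i.e. the $\pi\in C^2_{\mathsf{pL}}(\mathfrak a,\mathfrak a)$ with $\llbracket\pi,\pi\rrbracket_{\mathsf{pL}}=0$. -/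

import Mathlib

/-! ### Graded Lie algebras -/

section GradedLie

variable {k : Type*} [Field k] {L : ℕ → Type*} [∀ p, AddCommGroup (L p)] [∀ p, Module k (L p)]

/-- A family of bilinear maps `L p × L q → L (p + q)` is a graded Lie bracket on `⨁ p, L p` if it
is graded skew-symmetric, `[f, g] = -(-1)^{pq} [g, f]`, and satisfies the graded Jacobi identity
`[f, [g, h]] = [[f, g], h] + (-1)^{pq} [g, [f, h]]`. The equations are stated in the direct sum,
because `p + q` and `q + p` are different expressions for the same degree. -/
structure IsGradedLieBracket (br : ∀ p q, L p →ₗ[k] L q →ₗ[k] L (p + q)) : Prop where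
  skew : ∀ (p q : ℕ) (f : L p) (g : L q),
    DirectSum.lof k ℕ L (p + q) (br p q f g) =
      -((-1 : k) ^ (p * q) • DirectSum.lof k ℕ L (q + p) (br q p g f))
  jacobi : ∀ (p q r : ℕ) (f : L p) (g : L q) (h : L r),
    DirectSum.lof k ℕ L (p + (q + r)) (br p (q + r) f (br q r g h)) =
      DirectSum.lof k ℕ L (p + q + r) (br (p + q) r (br p q f g) h) +
        (-1 : k) ^ (p * q) •
          DirectSum.lof k ℕ L (q + (p + r)) (br q (p + r) g (br p r f h))

/-- Maurer–Cartan elements of a graded Lie algebra (with zero differential): elements of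
degree one with `[π, π] = 0`. -/
def IsMaurerCartan (br : ∀ p q, L p →ₗ[k] L q →ₗ[k] L (p + q)) (π : L 1) : Prop :=
  br 1 1 π π = 0

end GradedLie

/-! ### Pre-Leibniz structures -/

/-- A (left) pre-Leibniz algebra structure on the vector space `a`; `left x y` is `x ◁ y` and
`right x y` is `x ▷ y`. -/
@[ext]
structure PreLeibniz (k a : Type*) [Field k] [AddCommGroup a] [Module k a] where
  left : a →ₗ[k] a →ₗ[k] a
  right : a →ₗ[k] a →ₗ[k] a
  left_left : ∀ x y z : a,
    left x (left y z + right y z) = left (left x y) z + right y (left x z)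
  right_left : ∀ x y z : a,
    right x (left y z) = left (right x y) z + left y (left x z + right x z)
  right_right : ∀ x y z : a,
    right x (right y z) = right (left x y + right x y) z + right y (right x z)

/-! ### Cochains and the bracket -/

/-- The space `Hom (k[C_n] ⊗ a^{⊗ n}, a)`, written as linear maps from the free vector space
`k[C_n]` to the `n`-multilinear maps on `a`. The symbol `[r]`, `1 ≤ r ≤ n`, is the index `r - 1`
of `Fin n`. -/
abbrev PLCochain (k a : Type*) [Field k] [AddCommGroup a] [Module k a] (n : ℕ) : Type _ :=
  (Fin n →₀ k) →ₗ[k] MultilinearMap k (fun _ : Fin n => a) a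

namespace PLCochain

/-- For arities `m = p + 1`, `n = q + 1` and a (zero-based) box number `i`, the shuffles of
`Sh (i, q)`, regarded as permutations of all `N = m + n - 1` indices: `σ` is increasing on the
first `i` indices, increasing on the next `q` indices, and fixes the remaining ones. -/
def IsShuffle {N : ℕ} (i q : ℕ) (σ : Equiv.Perm (Fin N)) : Prop :=
  (∀ s t : Fin N, s < t → (t : ℕ) < i → σ s < σ t) ∧
  (∀ s t : Fin N, i ≤ (s : ℕ) → s < t → (t : ℕ) < i + q → σ s < σ t) ∧
  (∀ s : Fin N, i + q ≤ (s : ℕ) → σ s = s)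

instance {N : ℕ} (i q : ℕ) : DecidablePred (IsShuffle (N := N) i q) := fun σ => by
  unfold IsShuffle
  infer_instance

section Boxes

variable {N p q : ℕ}

/-- The sequence `σ 0, …, σ (N - 1)` is cut into `p + 1` boxes: box `i` receives `q + 1`
consecutive entries, every other box receives one. `box hN i s` is the box that contains
the `s`-th entry. -/
def box (hN : N = p + q + 1) (i : Fin (p + 1)) (s : Fin N) : Fin (p + 1) :=
  if h : (s : ℕ) < i then ⟨s, by omega⟩
  else if (s : ℕ) ≤ i + q then i
  else ⟨s - q, by omega⟩

/-- The map `R : C_{m+n-1} → C_m`: the box in which `r` appears. -/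
def R (hN : N = p + q + 1) (i : Fin (p + 1)) (σ : Equiv.Perm (Fin N)) (r : Fin N) : Fin (p + 1) :=
  box hN i (σ.symm r)

/-- The map `S : C_{m+n-1} → k[C_n]`: the position of `r` inside box `i` if `r` lies in that box,
and the sum of all basis elements otherwise. -/
noncomputable def S (k : Type*) [Field k] (i : Fin (p + 1)) (σ : Equiv.Perm (Fin N)) (r : Fin N) :
    Fin (q + 1) →₀ k :=
  if h : (i : ℕ) ≤ σ.symm r ∧ (σ.symm r : ℕ) ≤ i + q then
    Finsupp.single ⟨σ.symm r - i, by omega⟩ 1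
  else ∑ j : Fin (q + 1), Finsupp.single j 1

end Boxes

section Args

variable {a : Type*} {N p q : ℕ}

/-- The arguments `(x 0, …, x (i - 1), g (x i, …, x (i + q)), x (i + q + 1), …, x (p + q))`. -/
def insertArgs (hN : N = p + q + 1) (i : Fin (p + 1)) (g : (Fin (q + 1) → a) → a)
    (x : Fin N → a) : Fin (p + 1) → a :=
  Function.update
    (fun l : Fin (p + 1) => if (l : ℕ) < i then x ⟨l, by omega⟩ else x ⟨l + q, by omega⟩)
    i (g fun j : Fin (q + 1) => x ⟨i + j, by omega⟩)

theorem insertArgs_update_inner (hN : N = p + q + 1) (i : Fin (p + 1))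
    (g : (Fin (q + 1) → a) → a) (x : Fin N → a) (u : Fin N) (c : a)
    (h₁ : (i : ℕ) ≤ u) (h₂ : (u : ℕ) ≤ i + q) :
    insertArgs hN i g (Function.update x u c) =
      Function.update (insertArgs hN i g x) i
        (g (Function.update (fun j : Fin (q + 1) => x ⟨i + j, by omega⟩)
          ⟨u - i, by omega⟩ c)) := by
  funext l
  by_cases hl : l = i
  · subst hl
    simp only [insertArgs, Function.update_self]
    congr 1
    funext j
    simp only [Function.update_apply, Fin.ext_iff]
    grind
  · have hl' : (l : ℕ) ≠ i := fun e => hl (Fin.ext e)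
    simp only [insertArgs, Function.update_of_ne hl]
    split_ifs with hc
    · rw [Function.update_of_ne]
      simp only [ne_eq, Fin.ext_iff]
      omega
    · rw [Function.update_of_ne]
      simp only [ne_eq, Fin.ext_iff]
      omega

theorem insertArgs_update_outer (hN : N = p + q + 1) (i : Fin (p + 1))
    (g : (Fin (q + 1) → a) → a) (x : Fin N → a) (u : Fin N) (c : a)
    (h : ¬ ((i : ℕ) ≤ u ∧ (u : ℕ) ≤ i + q)) :
    insertArgs hN i g (Function.update x u c) =
      Function.update (insertArgs hN i g x) (box hN i u) c := by
  funext l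
  by_cases hl : l = i
  · subst hl
    have hb : l ≠ box hN l u := by
      simp only [box, ne_eq, Fin.ext_iff]
      grind
    simp only [insertArgs, Function.update_self, Function.update_of_ne hb]
    congr 1
    funext j
    rw [Function.update_of_ne]
    simp only [ne_eq, Fin.ext_iff]
    omega
  · have hl' : (l : ℕ) ≠ i := fun e => hl (Fin.ext e)
    simp only [insertArgs, box, Function.update_apply, Fin.ext_iff]
    grind

end Args

variable {k a : Type*} [Field k] [AddCommGroup a] [Module k a] {N p q : ℕ}

/-- The multilinear map
`x ↦ f (x 0, …, x (i - 1), g (x i, …, x (i + q)), x (i + q + 1), …, x (p + q))`. -/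
def insertAt (hN : N = p + q + 1) (i : Fin (p + 1))
    (f : MultilinearMap k (fun _ : Fin (p + 1) => a) a)
    (g : MultilinearMap k (fun _ : Fin (q + 1) => a) a) :
    MultilinearMap k (fun _ : Fin N => a) a :=
  MultilinearMap.mk' (fun x => f (insertArgs hN i g x))
    (by
      intro x u c d
      by_cases h : (i : ℕ) ≤ u ∧ (u : ℕ) ≤ i + q
      · simp only [insertArgs_update_inner hN i g x u _ h.1 h.2, MultilinearMap.map_update_add]
      · simp only [insertArgs_update_outer hN i g x u _ h, MultilinearMap.map_update_add])
    (by
      intro x u c d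
      by_cases h : (i : ℕ) ≤ u ∧ (u : ℕ) ≤ i + q
      · simp only [insertArgs_update_inner hN i g x u _ h.1 h.2, MultilinearMap.map_update_smul]
      · simp only [insertArgs_update_outer hN i g x u _ h, MultilinearMap.map_update_smul])

theorem insertAt_add_left (hN : N = p + q + 1) (i : Fin (p + 1))
    (f f' : MultilinearMap k (fun _ : Fin (p + 1) => a) a)
    (g : MultilinearMap k (fun _ : Fin (q + 1) => a) a) :
    insertAt hN i (f + f') g = insertAt hN i f g + insertAt hN i f' g := rfl

theorem insertAt_smul_left (hN : N = p + q + 1) (i : Fin (p + 1)) (c : k)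
    (f : MultilinearMap k (fun _ : Fin (p + 1) => a) a)
    (g : MultilinearMap k (fun _ : Fin (q + 1) => a) a) :
    insertAt hN i (c • f) g = c • insertAt hN i f g := rfl

theorem insertAt_add_right (hN : N = p + q + 1) (i : Fin (p + 1))
    (f : MultilinearMap k (fun _ : Fin (p + 1) => a) a)
    (g g' : MultilinearMap k (fun _ : Fin (q + 1) => a) a) :
    insertAt hN i f (g + g') = insertAt hN i f g + insertAt hN i f g' := by
  ext x
  simp [insertAt, insertArgs]

theorem insertAt_smul_right (hN : N = p + q + 1) (i : Fin (p + 1)) (c : k)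
    (f : MultilinearMap k (fun _ : Fin (p + 1) => a) a)
    (g : MultilinearMap k (fun _ : Fin (q + 1) => a) a) :
    insertAt hN i f (c • g) = c • insertAt hN i f g := by
  ext x
  simp [insertAt, insertArgs]

/-- The linear map `m ↦ (x ↦ m (x (σ 0), …, x (σ (N - 1))))`. -/
def permute (σ : Equiv.Perm (Fin N)) :
    MultilinearMap k (fun _ : Fin N => a) a →ₗ[k] MultilinearMap k (fun _ : Fin N => a) a where
  toFun m := m.domDomCongr σ
  map_add' _ _ := rfl
  map_smul' _ _ := rfl

/-- The operation `f ⋄_i g`, with `i` zero-based: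
`(f ⋄_i g) ([r]; x) = ∑ (-1)^σ f (R [r]; x_σ, …, g (S [r]; x_σ, …), …)`, the sum being over
the shuffles `σ`. -/
noncomputable def diamond (hN : N = p + q + 1) (i : Fin (p + 1))
    (f : PLCochain k a (p + 1)) (g : PLCochain k a (q + 1)) : PLCochain k a N :=
  Finsupp.linearCombination k fun r : Fin N =>
    ∑ σ : Equiv.Perm (Fin N) with IsShuffle i q σ,
      ((Equiv.Perm.sign σ : ℤ) : k) •
        permute σ (insertAt hN i (f (Finsupp.single (R hN i σ r) 1)) (g (S k i σ r)))

theorem diamond_add_left (hN : N = p + q + 1) (i : Fin (p + 1)) (f f' : PLCochain k a (p + 1))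
    (g : PLCochain k a (q + 1)) :
    diamond hN i (f + f') g = diamond hN i f g + diamond hN i f' g := by
  ext r : 2
  simp [diamond, insertAt_add_left, Finset.sum_add_distrib]

theorem diamond_smul_left (hN : N = p + q + 1) (i : Fin (p + 1)) (c : k)
    (f : PLCochain k a (p + 1)) (g : PLCochain k a (q + 1)) :
    diamond hN i (c • f) g = c • diamond hN i f g := by
  ext r : 2
  simp [diamond, insertAt_smul_left, Finset.smul_sum, smul_comm c]

theorem diamond_add_right (hN : N = p + q + 1) (i : Fin (p + 1)) (f : PLCochain k a (p + 1))
    (g g' : PLCochain k a (q + 1)) :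
    diamond hN i f (g + g') = diamond hN i f g + diamond hN i f g' := by
  ext r : 2
  simp [diamond, insertAt_add_right, Finset.sum_add_distrib]

theorem diamond_smul_right (hN : N = p + q + 1) (i : Fin (p + 1)) (c : k)
    (f : PLCochain k a (p + 1)) (g : PLCochain k a (q + 1)) :
    diamond hN i f (c • g) = c • diamond hN i f g := by
  ext r : 2
  simp [diamond, insertAt_smul_right, Finset.smul_sum, smul_comm c]

/-- The bracket of `f ∈ C^m` and `g ∈ C^n`, for `m = p + 1`, `n = q + 1`:
`[f, g] = ∑_{i=1}^m (-1)^{(i-1)(n-1)} f ⋄_i g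
    - (-1)^{(m-1)(n-1)} ∑_{i=1}^n (-1)^{(i-1)(m-1)} g ⋄_i f  ∈  C^{m+n-1}`. -/
noncomputable def bracketFun (f : PLCochain k a (p + 1)) (g : PLCochain k a (q + 1)) :
    PLCochain k a (p + q + 1) :=
  (∑ i : Fin (p + 1), (-1 : k) ^ ((i : ℕ) * q) • diamond rfl i f g) -
    (-1 : k) ^ (p * q) •
      ∑ i : Fin (q + 1), (-1 : k) ^ ((i : ℕ) * p) • diamond (by omega) i g f

/-- The bracket as a bilinear map `C^m × C^n → C^{m+n-1}`, for `m = p + 1`, `n = q + 1`. -/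
noncomputable def bracket (k a : Type*) [Field k] [AddCommGroup a] [Module k a] (p q : ℕ) :
    PLCochain k a (p + 1) →ₗ[k] PLCochain k a (q + 1) →ₗ[k] PLCochain k a (p + q + 1) :=
  LinearMap.mk₂ k bracketFun
    (fun f f' g => by
      simp only [bracketFun, diamond_add_left, diamond_add_right, smul_add,
        Finset.sum_add_distrib]
      abel)
    (fun c f g => by
      simp only [bracketFun, diamond_smul_left, diamond_smul_right, smul_sub, Finset.smul_sum,
        smul_comm c])
    (fun f g g' => by
      simp only [bracketFun, diamond_add_left, diamond_add_right, smul_add,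
        Finset.sum_add_distrib]
      abel)
    (fun c f g => by
      simp only [bracketFun, diamond_smul_left, diamond_smul_right, smul_sub, Finset.smul_sum,
        smul_comm c])

end PLCochain

/-! The bracket is a graded commutator of a graded right pre-Lie product, and such a commutator
satisfies the graded Jacobi identity. To avoid composing shuffles and shifting indices, an
`n`-cochain is replaced by a functional `eval f` of a finite set `I ⊆ ℕ` of positions, a label `r`
and letters `x : ℕ → a`: it vanishes unless `I` has `n` elements, and a label outside `I` stands for
the sum of all labels in `I`. This convention is exactly what `S` prescribes for an entry outside
box `i`.

In this language a pair (box `i`, shuffle `σ`) is just a block of `I`: the last entry `b` of the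
box, together with the set `A` of its other entries, all below `b`. The contracted box keeps the
position `b`, so no renumbering occurs. The sign `(-1)^{iq} (-1)^σ` becomes the parity of the pairs
`t < s` with `s ∈ A` and `t ∈ I \ A`, which is `crossSign`. Hence the signed sum of the `f ⋄_i g`
corresponds to `comp` (`eval_sum_diamond`).

Iterating `comp` gives a sum over pairs of blocks. Nested pairs make up `F ∘ (G ∘ H)`
(`comp_comp_nested`). The remaining, disjoint pairs form the associator, which is symmetric in `G`
and `H` up to the Koszul sign (`disjointPart_comm`); this is the pre-Lie identity `comp_preLie`.
Since `eval` is injective, skew-symmetry and Jacobi transfer to cochains.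

For a binary `π` one has `[π, π] = 2 π ∘ π`. On three positions `π ∘ π` has three terms, and the
three labels give the three pre-Leibniz axioms. -/

namespace PLCochain

/-! ### Signs of blocks. -/

section CrossSign

variable (k : Type*) [Field k]

/-- The sign of moving the letters indexed by `A` to the left of those indexed by `J`. -/
def crossSign (A J : Finset ℕ) : k :=
  ∏ s ∈ A, ∏ t ∈ J, if t < s then -1 else 1

theorem crossSign_union_left {A A' : Finset ℕ} (h : Disjoint A A') (J : Finset ℕ) :
    crossSign k (A ∪ A') J = crossSign k A J * crossSign k A' J :=
  Finset.prod_union h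

theorem crossSign_union_right (A : Finset ℕ) {J J' : Finset ℕ} (h : Disjoint J J') :
    crossSign k A (J ∪ J') = crossSign k A J * crossSign k A J' := by
  simp only [crossSign, Finset.prod_union h, Finset.prod_mul_distrib]

theorem crossSign_eq_one {A J : Finset ℕ} (h : ∀ s ∈ A, ∀ t ∈ J, ¬ t < s) :
    crossSign k A J = 1 :=
  Finset.prod_eq_one fun s hs => Finset.prod_eq_one fun t ht => if_neg (h s hs t ht)

theorem crossSign_mul_swap {A A' : Finset ℕ} (h : Disjoint A A') :
    crossSign k A A' * crossSign k A' A = (-1) ^ (A.card * A'.card) := by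
  have h₁ : crossSign k A' A = ∏ s ∈ A, ∏ t ∈ A', if s < t then -1 else 1 :=
    Finset.prod_comm
  rw [h₁, crossSign, ← Finset.prod_mul_distrib]
  have h₂ : ∀ s ∈ A, ((∏ t ∈ A', if t < s then (-1 : k) else 1) *
      ∏ t ∈ A', if s < t then (-1 : k) else 1) = (-1) ^ A'.card := by
    intro s hs
    rw [← Finset.prod_mul_distrib, ← Finset.prod_const]
    refine Finset.prod_congr rfl fun t ht => ?_
    rcases lt_trichotomy s t with hst | hst | hst
    · simp [hst, hst.not_gt]
    · exact absurd (hst ▸ ht) (Finset.disjoint_left.mp h hs)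
    · simp [hst, hst.not_gt]
  rw [Finset.prod_congr rfl h₂, Finset.prod_const, ← pow_mul, mul_comm]

theorem crossSign_mul_self (A J : Finset ℕ) : crossSign k A J * crossSign k A J = 1 := by
  rw [crossSign, ← Finset.prod_mul_distrib]
  refine Finset.prod_eq_one fun s _ => ?_
  rw [← Finset.prod_mul_distrib]
  refine Finset.prod_eq_one fun t _ => ?_
  split_ifs <;> simp

/-- Extracting two disjoint sets in either order counts the same crossings with the rest of `I`;
only the crossings between `A` and `A'` are counted from opposite sides, and every such pair is
crossed in exactly one of the two orders. -/
theorem crossSign_disjoint_comm {A A' I : Finset ℕ} (hA : A ⊆ I) (hA' : A' ⊆ I)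
    (h : Disjoint A A') :
    crossSign k A (I \ A) * crossSign k A' ((I \ A) \ A') =
      (-1) ^ (A.card * A'.card) *
        (crossSign k A' (I \ A') * crossSign k A ((I \ A') \ A)) := by
  have hd := Finset.disjoint_left.mp h
  have e₁ : I \ A = A' ∪ ((I \ A) \ A') := by grind
  have e₂ : I \ A' = A ∪ ((I \ A) \ A') := by grind
  have e₃ : (I \ A') \ A = (I \ A) \ A' := by grind
  have d₁ : Disjoint A' ((I \ A) \ A') := Finset.disjoint_sdiff
  have d₂ : Disjoint A ((I \ A) \ A') := by
    rw [Finset.disjoint_left]; grind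
  rw [← crossSign_mul_swap k h, e₃]
  conv_lhs => rw [e₁, crossSign_union_right k A d₁, ← e₁]
  conv_rhs => rw [e₂, crossSign_union_right k A' d₂]
  linear_combination (-crossSign k A A' * crossSign k A ((I \ A) \ A') *
    crossSign k A' ((I \ A) \ A')) * crossSign_mul_self k A' A

/-- Both sides count the crossings of `A` with `A'` once and those of `A ∪ A'` with its complement
once. The extra element `b` contributes nothing, as it lies above `A`. -/
theorem crossSign_nested {A A' I : Finset ℕ} {b : ℕ} (hA' : A' ⊆ I)
    (h : Disjoint A A') (hAb : ∀ s ∈ A, s < b) (hAb' : ∀ s ∈ A', s < b) :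
    crossSign k A (I \ A) * crossSign k A' ((I \ A) \ A') =
      crossSign k (A ∪ A') (I \ (A ∪ A')) * crossSign k A (insert b (A ∪ A') \ A) := by
  have hd := Finset.disjoint_left.mp h
  have e₁ : I \ A = A' ∪ (I \ (A ∪ A')) := by grind
  have e₂ : (I \ A) \ A' = I \ (A ∪ A') := by grind
  have hbA' : b ∉ A' := fun hb' => lt_irrefl _ (hAb' b hb')
  have e₃ : insert b (A ∪ A') \ A = A' ∪ {b} := by
    grind
  have d₁ : Disjoint A' (I \ (A ∪ A')) := by
    rw [Finset.disjoint_left]; grind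
  have d₂ : Disjoint A' {b} := by simpa using hbA'
  rw [e₂, e₁, e₃, crossSign_union_right k A d₁, crossSign_union_right k A d₂,
    crossSign_union_left k h, crossSign_eq_one k (J := {b}) (A := A)]
  · ring
  · intro s hs t ht
    rw [Finset.mem_singleton.mp ht]
    exact (hAb s hs).not_gt

end CrossSign

/-! ### Labelled functionals and their pre-Lie composition. -/

section Functional

variable (k a : Type*) [Field k] [AddCommGroup a] [Module k a]

/-- Labelled functionals: to a finite set `I` of positions, a label `r` and a family of letters
`x`, they assign a value. -/
abbrev Functional (a : Type*) : Type _ := Finset ℕ → ℕ → (ℕ → a) → a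

variable {a} in
/-- The properties of the functionals that come from `(n + 1)`-cochains. -/
structure IsCochainLike (n : ℕ) (F : Functional a) : Prop where
  eq_zero : ∀ I r x, I.card ≠ n + 1 → F I r x = 0
  congr_arg : ∀ I r x y, (∀ i ∈ I, x i = y i) → F I r x = F I r y
  eq_sum_label : ∀ I r x, r ∉ I → F I r x = ∑ s ∈ I, F I s x
  map_add : ∀ I r x b, b ∈ I → ∀ u v, F I r (Function.update x b (u + v)) =
    F I r (Function.update x b u) + F I r (Function.update x b v)
  map_smul : ∀ I r x b, b ∈ I → ∀ (c : k) (u : a), F I r (Function.update x b (c • u)) =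
    c • F I r (Function.update x b u)

/-- The pairs of an element `b` of `I` and a set `A` of elements of `I` below `b`. -/
def blocks (I : Finset ℕ) : Finset (ℕ × Finset ℕ) :=
  {z ∈ I ×ˢ I.powerset | ∀ s ∈ z.2, s < z.1}

theorem mem_blocks {I : Finset ℕ} {b : ℕ} {A : Finset ℕ} :
    (b, A) ∈ blocks I ↔ b ∈ I ∧ A ⊆ I ∧ ∀ s ∈ A, s < b := by
  simp [blocks, and_assoc]

variable {a}

/-- The summand of `comp F G` in which the block `A ∪ {b}` is contracted to `b` by `G`. -/
def compTerm (F G : Functional a) (I : Finset ℕ) (r : ℕ) (x : ℕ → a) (b : ℕ) (A : Finset ℕ) : a :=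
  F (I \ A) (if r ∈ A then b else r) (Function.update x b (G (insert b A) r x))

/-- The composition of functionals: a signed sum over all ways to contract a block by `G`. -/
def comp (F G : Functional a) : Functional a := fun I r x =>
  ∑ z ∈ blocks I, crossSign k z.2 (I \ z.2) • compTerm F G I r x z.1 z.2

variable {k}

theorem IsCochainLike.congr_label {n : ℕ} {F : Functional a} (hF : IsCochainLike k n F)
    {I : Finset ℕ} {r r' : ℕ} (x : ℕ → a) (hr : r ∉ I) (hr' : r' ∉ I) : F I r x = F I r' x := by
  rw [hF.eq_sum_label I r x hr, hF.eq_sum_label I r' x hr']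

theorem IsCochainLike.map_zero {n : ℕ} {F : Functional a} (hF : IsCochainLike k n F)
    {I : Finset ℕ} {b : ℕ} (hb : b ∈ I) (r : ℕ) (x : ℕ → a) :
    F I r (Function.update x b 0) = 0 := by
  simpa using hF.map_smul I r x b hb 0 0

theorem IsCochainLike.map_sum {n : ℕ} {F : Functional a} (hF : IsCochainLike k n F)
    {I : Finset ℕ} {b : ℕ} (hb : b ∈ I) (r : ℕ) (x : ℕ → a) {ι : Type*} (s : Finset ι)
    (v : ι → a) :
    F I r (Function.update x b (∑ z ∈ s, v z)) = ∑ z ∈ s, F I r (Function.update x b (v z)) := by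
  classical
  induction s using Finset.induction_on with
  | empty => simpa using hF.map_zero hb r x
  | insert z s hz ih => rw [Finset.sum_insert hz, Finset.sum_insert hz, hF.map_add _ _ _ _ hb, ih]

/-- `blocks` puts no restriction on the size of a block; it is the vanishing of `G` on sets of the
wrong size that selects the blocks of the right arity. -/
theorem compTerm_eq_zero {p q : ℕ} {F G : Functional a} (hF : IsCochainLike k p F)
    (hG : IsCochainLike k q G) {I : Finset ℕ} (r : ℕ) (x : ℕ → a) {b : ℕ} {A : Finset ℕ}
    (h : (b, A) ∈ blocks I) (hA : A.card ≠ q) : compTerm F G I r x b A = 0 := by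
  rw [mem_blocks] at h
  have hb : b ∉ A := fun hb => lt_irrefl _ (h.2.2 b hb)
  rw [compTerm, hG.eq_zero, hF.map_zero]
  · grind
  · rw [Finset.card_insert_of_notMem hb]
    omega

/-- For each block, the labels inside it all become `b` for `F` and add up to an outside label for
`G`. The other labels already are outside labels for `G`, so altogether every label of `I \ A`
occurs once in `F`. -/
theorem comp_eq_sum_label {p q : ℕ} {F G : Functional a} (hF : IsCochainLike k p F)
    (hG : IsCochainLike k q G) {I : Finset ℕ} {r : ℕ} (hr : r ∉ I) (x : ℕ → a) :
    comp k F G I r x = ∑ s ∈ I, comp k F G I s x := by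
  simp only [comp]
  rw [Finset.sum_comm]
  refine Finset.sum_congr rfl fun z hz => ?_
  obtain ⟨b, A⟩ := z
  obtain ⟨hb, hA, hlt⟩ := mem_blocks.mp hz
  have hbA : b ∉ A := fun h => lt_irrefl _ (hlt _ h)
  have hb' : b ∈ I \ A := Finset.mem_sdiff.mpr ⟨hb, hbA⟩
  have hrA : r ∉ A := fun h => hr (hA h)
  have hrB : r ∉ insert b A := by grind
  rw [← Finset.smul_sum]
  congr 1
  dsimp only
  have hI : I = insert b A ∪ (I \ A).erase b := by grind
  have hd : Disjoint (insert b A) ((I \ A).erase b) := by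
    rw [Finset.disjoint_left]; grind
  have h₁ : ∑ s ∈ insert b A, compTerm F G I s x b A =
      F (I \ A) b (Function.update x b (G (insert b A) r x)) := by
    rw [hG.eq_sum_label _ r x hrB, hF.map_sum hb']
    refine Finset.sum_congr rfl fun s hs => ?_
    have : (if s ∈ A then b else s) = b := by grind
    rw [compTerm, this]
  have h₂ : ∑ s ∈ (I \ A).erase b, compTerm F G I s x b A =
      ∑ s ∈ (I \ A).erase b, F (I \ A) s (Function.update x b (G (insert b A) r x)) := by
    refine Finset.sum_congr rfl fun s hs => ?_
    have hsA : s ∉ A := by grind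
    rw [compTerm, if_neg hsA, hG.congr_label x (r := s) (r' := r) (by grind) hrB]
  conv_rhs => rw [hI]
  rw [Finset.sum_union hd, ← hI, h₁, h₂, compTerm, if_neg hrA,
    hF.eq_sum_label _ r _ (by grind), ← Finset.add_sum_erase _ _ hb']

theorem comp_add_left (F F' G : Functional a) :
    comp k (F + F') G = comp k F G + comp k F' G := by
  funext I r x
  simp [comp, compTerm, Finset.sum_add_distrib]

theorem comp_smul_left (c : k) (F G : Functional a) : comp k (c • F) G = c • comp k F G := by
  funext I r x
  simp [comp, compTerm, Finset.smul_sum, smul_comm c]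

theorem comp_add_right {p : ℕ} {F : Functional a} (hF : IsCochainLike k p F)
    (G G' : Functional a) : comp k F (G + G') = comp k F G + comp k F G' := by
  funext I r x
  simp only [comp, compTerm, Pi.add_apply, ← Finset.sum_add_distrib, ← smul_add]
  refine Finset.sum_congr rfl fun z hz => ?_
  obtain ⟨hb, hA, hlt⟩ := mem_blocks.mp hz
  rw [hF.map_add]
  exact Finset.mem_sdiff.mpr ⟨hb, fun h => lt_irrefl _ (hlt _ h)⟩

theorem comp_smul_right {p : ℕ} {F : Functional a} (hF : IsCochainLike k p F) (c : k)
    (G : Functional a) : comp k F (c • G) = c • comp k F G := by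
  funext I r x
  simp only [comp, compTerm, Pi.smul_apply, Finset.smul_sum]
  refine Finset.sum_congr rfl fun z hz => ?_
  obtain ⟨hb, hA, hlt⟩ := mem_blocks.mp hz
  rw [hF.map_smul, smul_comm]
  exact Finset.mem_sdiff.mpr ⟨hb, fun h => lt_irrefl _ (hlt _ h)⟩

/-- The pairs of successive contractions of blocks of `I`. -/
def blockPairs (I : Finset ℕ) : Finset (Σ _ : ℕ × Finset ℕ, ℕ × Finset ℕ) :=
  (blocks I).sigma fun z => blocks (I \ z.2)

theorem mem_blockPairs {I : Finset ℕ} {c b : ℕ} {A A' : Finset ℕ} :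
    (⟨(c, A), (b, A')⟩ : Σ _ : ℕ × Finset ℕ, ℕ × Finset ℕ) ∈ blockPairs I ↔
      (c ∈ I ∧ A ⊆ I ∧ ∀ s ∈ A, s < c) ∧ (b ∈ I \ A ∧ A' ⊆ I \ A ∧ ∀ s ∈ A', s < b) := by
  simp only [blockPairs, Finset.mem_sigma, mem_blocks]

variable (k) in
/-- The part of `comp (comp F G) H` in which the blocks contracted by `G` and `H` are disjoint. -/
def disjointPart (F G H : Functional a) : Functional a := fun I r x =>
  ∑ w ∈ blockPairs I with w.1.1 ∉ insert w.2.1 w.2.2,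
    (crossSign k w.1.2 (I \ w.1.2) * crossSign k w.2.2 ((I \ w.1.2) \ w.2.2)) •
      F ((I \ w.1.2) \ w.2.2) (if r ∈ w.2.2 then w.2.1 else if r ∈ w.1.2 then w.1.1 else r)
        (Function.update (Function.update x w.1.1 (H (insert w.1.1 w.1.2) r x)) w.2.1
          (G (insert w.2.1 w.2.2) r x))

/-- If the position `c` of the first contracted block belongs to the second block, then the two
contractions together contract one larger block by `G ∘ H`. -/
theorem comp_comp_nested {p : ℕ} {F : Functional a} (hF : IsCochainLike k p F)
    (G H : Functional a) (I : Finset ℕ) (r : ℕ) (x : ℕ → a) :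
    (∑ w ∈ blockPairs I with w.1.1 ∈ insert w.2.1 w.2.2,
      (crossSign k w.1.2 (I \ w.1.2) * crossSign k w.2.2 ((I \ w.1.2) \ w.2.2)) •
        compTerm F G (I \ w.1.2) (if r ∈ w.1.2 then w.1.1 else r)
          (Function.update x w.1.1 (H (insert w.1.1 w.1.2) r x)) w.2.1 w.2.2) =
      comp k F (comp k G H) I r x := by
  have key : comp k F (comp k G H) I r x =
      ∑ w ∈ (blocks I).sigma fun z => blocks (insert z.1 z.2),
        (crossSign k w.1.2 (I \ w.1.2) * crossSign k w.2.2 (insert w.1.1 w.1.2 \ w.2.2)) •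
          F (I \ w.1.2) (if r ∈ w.1.2 then w.1.1 else r) (Function.update x w.1.1
            (compTerm G H (insert w.1.1 w.1.2) r x w.2.1 w.2.2)) := by
    rw [Finset.sum_sigma]
    refine Finset.sum_congr rfl fun z hz => ?_
    obtain ⟨hb, hA, hlt⟩ := mem_blocks.mp hz
    have hb' : z.1 ∈ I \ z.2 := Finset.mem_sdiff.mpr ⟨hb, fun h => lt_irrefl _ (hlt _ h)⟩
    rw [compTerm, comp, hF.map_sum hb', Finset.smul_sum]
    refine Finset.sum_congr rfl fun w _ => ?_
    rw [hF.map_smul _ _ _ _ hb', mul_smul]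
  rw [key]
  -- Blocks `(c, A)`, then `(b, A')`, correspond to the large block `(b, A ∪ A')` containing the
  -- inner block `(c, A)`; since `c ≤ b`, the set `A` also lies below `b`.
  refine Finset.sum_bij' (fun w _ => ⟨(w.2.1, w.1.2 ∪ w.2.2), (w.1.1, w.1.2)⟩)
    (fun w _ => ⟨(w.2.1, w.2.2), (w.1.1, w.1.2 \ w.2.2)⟩) ?_ ?_ ?_ ?_ ?_
  · rintro ⟨⟨c, A⟩, ⟨b, A'⟩⟩ hw
    simp only [Finset.mem_filter, mem_blockPairs, Finset.mem_sigma, mem_blocks] at hw ⊢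
    grind
  · rintro ⟨⟨b, D⟩, ⟨c, A⟩⟩ hw
    simp only [Finset.mem_filter, mem_blockPairs, Finset.mem_sigma, mem_blocks] at hw ⊢
    grind
  · rintro ⟨⟨c, A⟩, ⟨b, A'⟩⟩ hw
    simp only [Finset.mem_filter, mem_blockPairs] at hw
    have : (A ∪ A') \ A = A' := by grind
    simp [this]
  · rintro ⟨⟨b, D⟩, ⟨c, A⟩⟩ hw
    simp only [Finset.mem_sigma, mem_blocks] at hw
    have : A ∪ (D \ A) = D := by grind
    simp [this]
  · rintro ⟨⟨c, A⟩, ⟨b, A'⟩⟩ hw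
    simp only [Finset.mem_filter, mem_blockPairs] at hw
    obtain ⟨⟨⟨hc, hA, hAc⟩, hb, hA', hAb'⟩, hcb⟩ := hw
    have hcb' : c ≤ b := by grind
    have hd : Disjoint A A' := by rw [Finset.disjoint_left]; grind
    dsimp only
    rw [crossSign_nested k (b := b) (by grind) hd (by grind) hAb']
    congr 1
    have e₁ : insert b (A ∪ A') \ A = insert b A' := by
      have := Finset.disjoint_left.mp hd
      grind
    have e₂ : (I \ A) \ A' = I \ (A ∪ A') := by grind
    have e₃ : (if (if r ∈ A then c else r) ∈ A' then b else if r ∈ A then c else r) =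
        if r ∈ A ∪ A' then b else r := by grind
    simp only [compTerm, e₁, e₂, e₃]
    apply hF.congr_arg
    intro i hi
    by_cases hib : i = b
    · simp [hib]
    · rw [Function.update_of_ne hib, Function.update_of_ne hib, Function.update_of_ne]
      grind

theorem comp_comp {p q : ℕ} {F G : Functional a} (hF : IsCochainLike k p F)
    (hG : IsCochainLike k q G) (H : Functional a) :
    comp k (comp k F G) H = comp k F (comp k G H) + disjointPart k F G H := by
  funext I r x
  have key : comp k (comp k F G) H I r x = ∑ w ∈ blockPairs I,
      (crossSign k w.1.2 (I \ w.1.2) * crossSign k w.2.2 ((I \ w.1.2) \ w.2.2)) •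
        compTerm F G (I \ w.1.2) (if r ∈ w.1.2 then w.1.1 else r)
          (Function.update x w.1.1 (H (insert w.1.1 w.1.2) r x)) w.2.1 w.2.2 := by
    rw [blockPairs, Finset.sum_sigma]
    refine Finset.sum_congr rfl fun z _ => ?_
    simp only [compTerm, comp, Finset.smul_sum, mul_smul]
  -- Either the value of `H` at position `c` is fed into `G`, or the two blocks are disjoint.
  rw [key, ← Finset.sum_filter_add_sum_filter_not _ (fun w => w.1.1 ∈ insert w.2.1 w.2.2),
    comp_comp_nested hF, Pi.add_apply, Pi.add_apply, Pi.add_apply, disjointPart]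
  congr 1
  refine Finset.sum_congr rfl ?_
  rintro ⟨⟨c, A⟩, ⟨b, A'⟩⟩ hw
  simp only [Finset.mem_filter, mem_blockPairs] at hw
  obtain ⟨⟨⟨hc, hA, hAc⟩, hb, hA', hAb'⟩, hcb⟩ := hw
  have e₁ : (if (if r ∈ A then c else r) ∈ A' then b else if r ∈ A then c else r) =
      if r ∈ A' then b else if r ∈ A then c else r := by grind
  -- For disjoint blocks `G` sees neither the new letter at `c` nor the change of label: when `r ∈
  -- A`, both `r` and `c` are outside the block of `G`.
  have e₂ : G (insert b A') (if r ∈ A then c else r)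
      (Function.update x c (H (insert c A) r x)) = G (insert b A') r x := by
    rw [hG.congr_arg _ _ _ x]
    · split_ifs with hr
      · exact hG.congr_label _ hcb (by grind)
      · rfl
    · intro i hi
      rw [Function.update_of_ne]
      rintro rfl
      exact hcb hi
  simp only [compTerm, e₁, e₂]

/-- Disjoint contractions commute, so exchanging the two blocks matches the summands, up to the sign
of `crossSign_disjoint_comm`. -/
theorem disjointPart_comm {p q n : ℕ} {F G H : Functional a} (hF : IsCochainLike k p F)
    (hG : IsCochainLike k q G) (hH : IsCochainLike k n H) :
    disjointPart k F G H = (-1 : k) ^ (q * n) • disjointPart k F H G := by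
  funext I r x
  simp only [disjointPart, Pi.smul_apply, Finset.smul_sum]
  refine Finset.sum_bij' (fun w _ => ⟨w.2, w.1⟩) (fun w _ => ⟨w.2, w.1⟩) ?_ ?_ ?_ ?_ ?_
  · rintro ⟨⟨c, A⟩, ⟨b, A'⟩⟩ hw
    simp only [Finset.mem_filter, mem_blockPairs] at hw ⊢
    grind
  · rintro ⟨⟨c, A⟩, ⟨b, A'⟩⟩ hw
    simp only [Finset.mem_filter, mem_blockPairs] at hw ⊢
    grind
  · intros; rfl
  · intros; rfl
  · rintro ⟨⟨c, A⟩, ⟨b, A'⟩⟩ hw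
    simp only [Finset.mem_filter, mem_blockPairs] at hw
    obtain ⟨⟨⟨hc, hA, hAc⟩, hb, hA', hAb'⟩, hcb⟩ := hw
    have hd : Disjoint A A' := by rw [Finset.disjoint_left]; grind
    have hbc : b ≠ c := by grind
    have e₁ : (I \ A') \ A = (I \ A) \ A' := by grind
    have e₂ : (if r ∈ A then c else if r ∈ A' then b else r) =
        if r ∈ A' then b else if r ∈ A then c else r := by
      have := Finset.disjoint_left.mp hd
      grind
    have hbm : b ∈ (I \ A) \ A' := by grind
    have hcm : c ∈ (I \ A) \ A' := by grind
    dsimp only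
    rw [crossSign_disjoint_comm k hA (by grind) hd, e₁, e₂, Function.update_comm hbc, smul_smul]
    -- The sign depends on the block sizes, but both summands vanish unless these are the arities
    -- prescribed by `H` and `G`.
    by_cases h₁ : A.card = n
    · by_cases h₂ : A'.card = q
      · rw [h₁, h₂, mul_comm n q]
      · have h₃ : G (insert b A') r x = 0 := by
          apply hG.eq_zero
          rw [Finset.card_insert_of_notMem (fun h => lt_irrefl _ (hAb' b h))]
          omega
        rw [h₃, hF.map_zero hbm, smul_zero, smul_zero]
    · have h₃ : H (insert c A) r x = 0 := by
        apply hH.eq_zero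
        rw [Finset.card_insert_of_notMem (fun h => lt_irrefl _ (hAc c h))]
        omega
      rw [h₃, Function.update_comm hbc.symm, hF.map_zero hcm, smul_zero, smul_zero]

/-- The graded right pre-Lie identity. -/
theorem comp_preLie {p q n : ℕ} {F G H : Functional a} (hF : IsCochainLike k p F)
    (hG : IsCochainLike k q G) (hH : IsCochainLike k n H) :
    comp k (comp k F G) H - comp k F (comp k G H) =
      (-1 : k) ^ (q * n) • (comp k (comp k F H) G - comp k F (comp k H G)) := by
  rw [comp_comp hF hG, comp_comp hF hH, add_sub_cancel_left, add_sub_cancel_left,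
    disjointPart_comm hF hG hH]

end Functional

end PLCochain

namespace PLCochain

/-! ### Shuffles are determined by the entries of the box, and their signs. -/

section Shuffle

variable {N i q : ℕ} {σ τ : Equiv.Perm (Fin N)}

theorem IsShuffle.val_lt_iff (hσ : IsShuffle i q σ) (s : Fin N) :
    (σ s : ℕ) < i + q ↔ (s : ℕ) < i + q := by
  constructor
  · intro h
    by_contra hs
    rw [hσ.2.2 s (by omega)] at h
    exact hs h
  · intro h
    by_contra hs
    have := σ.injective (hσ.2.2 (σ s) (by omega))
    rw [this] at hs
    exact hs h

/-- Sorting by this key puts the elements below `b` outside `A` first, then those of `A`, then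
the elements from `b` on. -/
def shuffleKey (A : Finset (Fin N)) (b s : Fin N) : ℕ :=
  if s ∈ A then 1 else if s < b then 0 else 2

/-- A shuffle lists the three key classes in order and each class increasingly, which characterizes
the stable sort by the key. So it depends only on the image of its middle segment. -/
theorem IsShuffle.eq_sort (hσ : IsShuffle i q σ) (h : i + q < N) :
    σ = Tuple.sort (shuffleKey ((Finset.Ico ⟨i, by omega⟩ ⟨i + q, h⟩).image σ) ⟨i + q, h⟩) := by
  have hkey : ∀ s : Fin N,
      shuffleKey ((Finset.Ico ⟨i, by omega⟩ ⟨i + q, h⟩).image σ) ⟨i + q, h⟩ (σ s) =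
        if i ≤ (s : ℕ) ∧ (s : ℕ) < i + q then 1 else if (s : ℕ) < i + q then 0 else 2 := by
    intro s
    have := hσ.val_lt_iff s
    simp [shuffleKey, Fin.lt_def, Fin.le_def, this]
  rw [Tuple.eq_sort_iff]
  simp only [hkey]
  refine ⟨fun s t hst => ?_, fun s t hst => ?_⟩
  · have : (s : ℕ) ≤ t := hst
    simp only [Function.comp_apply, hkey]
    grind
  · have hst' : (s : ℕ) < t := hst
    intro he
    by_cases h₁ : (t : ℕ) < i
    · exact hσ.1 s t hst h₁
    by_cases h₂ : (t : ℕ) < i + q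
    · exact hσ.2.1 s t (by grind) hst h₂
    · rw [hσ.2.2 s (by grind), hσ.2.2 t (by omega)]
      exact hst

theorem IsShuffle.eq_of_image_eq (hσ : IsShuffle i q σ) (hτ : IsShuffle i q τ) (h : i + q < N)
    (he : (Finset.Ico (⟨i, by omega⟩ : Fin N) ⟨i + q, h⟩).image σ =
      (Finset.Ico (⟨i, by omega⟩ : Fin N) ⟨i + q, h⟩).image τ) : σ = τ := by
  rw [hσ.eq_sort h, hτ.eq_sort h, he]

/-- The stable sort by `shuffleKey` is the required shuffle; the sizes of the key classes locate
their segments. -/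
theorem exists_isShuffle (A : Finset (Fin N)) (b : Fin N) (hA : ∀ s ∈ A, s < b) :
    A.card ≤ b ∧ ∃ σ : Equiv.Perm (Fin N), IsShuffle (b - A.card) A.card σ ∧
      (Finset.Ico ⟨b - A.card, by omega⟩ b).image σ = A := by
  have hsub : A ⊆ Finset.Iio b := fun s hs => Finset.mem_Iio.mpr (hA s hs)
  have hcard : A.card ≤ b := by simpa using Finset.card_le_card hsub
  refine ⟨hcard, ?_⟩
  set q := A.card with hq
  set σ := Tuple.sort (shuffleKey A b) with hσ
  obtain ⟨hmono, hstable⟩ := Tuple.eq_sort_iff.mp hσ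
  have hcount : ∀ c, (Finset.univ.filter fun s => (shuffleKey A b ∘ σ) s < c).card =
      (Finset.univ.filter fun s => shuffleKey A b s < c).card := fun c =>
    Finset.card_equiv σ (by simp)
  have h₀ : ∀ s : Fin N, shuffleKey A b (σ s) < 1 ↔ (s : ℕ) < b - q := by
    intro s
    have h := Tuple.lt_card_lt_iff_apply_lt_of_monotone (j := s) (a := 1) hmono
    rw [hcount] at h
    rw [← Function.comp_apply (f := shuffleKey A b), ← h]
    have : (Finset.univ.filter fun s => shuffleKey A b s < 1) = Finset.Iio b \ A := by
      ext t
      simp only [shuffleKey, Finset.mem_sdiff, Finset.mem_Iio]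
      grind
    rw [this, Finset.card_sdiff_of_subset hsub, Fin.card_Iio]
  have h₁ : ∀ s : Fin N, shuffleKey A b (σ s) < 2 ↔ (s : ℕ) < b := by
    intro s
    have h := Tuple.lt_card_lt_iff_apply_lt_of_monotone (j := s) (a := 2) hmono
    rw [hcount] at h
    rw [← Function.comp_apply (f := shuffleKey A b), ← h]
    have : (Finset.univ.filter fun s => shuffleKey A b s < 2) = Finset.Iio b := by
      ext t
      simp only [shuffleKey, Finset.mem_Iio]
      grind
    rw [this, Fin.card_Iio]
  have hle : ∀ s : Fin N, shuffleKey A b s ≤ 2 := by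
    intro s
    unfold shuffleKey
    split_ifs <;> omega
  have hone : ∀ s : Fin N, shuffleKey A b s = 1 ↔ s ∈ A := by
    intro s
    unfold shuffleKey
    split_ifs <;> simp_all
  have htwo : ∀ s : Fin N, shuffleKey A b s = 2 ↔ b ≤ s := by
    intro s
    unfold shuffleKey
    grind
  -- The sort permutes the indices from `b` on and is increasing there, hence is the identity; this
  -- is proved by strong induction.
  have hfix : ∀ s : Fin N, b ≤ s → σ s = s := by
    intro s
    induction s using WellFoundedLT.induction with
    | ind s ih =>
      intro hs
      have hs' : (b : ℕ) ≤ s := hs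
      have hks : shuffleKey A b (σ s) = 2 := by
        have := h₁ s
        have := hle (σ s)
        omega
      have hbs := (htwo _).mp hks
      rcases lt_trichotomy (σ s) s with h | h | h
      · exact σ.injective (ih _ h hbs)
      · exact h
      · obtain ⟨u, hu⟩ := σ.surjective s
        have hku : shuffleKey A b (σ u) = 2 := by rw [hu]; exact (htwo _).mpr hs
        have hbu : b ≤ u := by
          have := h₁ u
          rw [Fin.le_def]
          omega
        rcases lt_trichotomy u s with hus | hus | hus
        · rw [ih u hus hbu] at hu
          exact absurd hu hus.ne
        · rw [← hus, hu, hus]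
        · have := hstable s u hus (hks.trans hku.symm)
          rw [hu] at this
          exact absurd this h.not_gt
  refine ⟨σ, ⟨fun s t hst ht => ?_, fun s t hs hst ht => ?_, fun s hs => ?_⟩, ?_⟩
  · refine hstable s t hst ?_
    have := (h₀ s).mpr (lt_trans hst ht)
    have := (h₀ t).mpr ht
    omega
  · have hst' : (s : ℕ) < t := hst
    refine hstable s t hst ?_
    have := h₀ s
    have := h₁ s
    have := h₀ t
    have := h₁ t
    omega
  · refine hfix s ?_
    rw [Fin.le_def]
    omega
  · ext t
    obtain ⟨s, rfl⟩ := σ.surjective t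
    rw [σ.injective.mem_finset_image, ← hone, Finset.mem_Ico, Fin.le_def, Fin.lt_def]
    have := h₀ s
    have := h₁ s
    dsimp only
    omega

variable (k : Type*) [Field k]

/-- Only pairs `t < i ≤ s < i + q` can be inverted by `σ`. There are `i * q` of them, so the factor
`(-1)^{iq}` turns the parity of inverted pairs into that of non-inverted ones, which `crossSign`
records. Entries from `i + q` on lie above the block and do not count. -/
theorem IsShuffle.sign_eq (hσ : IsShuffle i q σ) (h : i + q < N) {e : Fin N → ℕ}
    (he : StrictMono e) :
    (-1 : k) ^ (i * q) * ((Equiv.Perm.sign σ : ℤ) : k) =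
      crossSign k ((Finset.Ico ⟨i, by omega⟩ ⟨i + q, h⟩).image (e ∘ σ))
        (Finset.univ.image e \ (Finset.Ico ⟨i, by omega⟩ ⟨i + q, h⟩).image (e ∘ σ)) := by
  set iF : Fin N := ⟨i, by omega⟩ with hiF
  set bF : Fin N := ⟨i + q, h⟩ with hbF
  have hinj : Function.Injective (e ∘ σ) := he.injective.comp σ.injective
  have hI : Finset.univ.image e = (Finset.univ.image (e ∘ σ)) := by
    ext t
    simp only [Finset.mem_image, Finset.mem_univ, true_and, Function.comp_apply]
    exact ⟨fun ⟨s, hs⟩ => ⟨σ.symm s, by simpa using hs⟩, fun ⟨s, hs⟩ => ⟨σ s, hs⟩⟩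
  have hR : crossSign k ((Finset.Ico iF bF).image (e ∘ σ))
      (Finset.univ.image e \ (Finset.Ico iF bF).image (e ∘ σ)) =
      ∏ s ∈ Finset.Ico iF bF, ∏ t ∈ Finset.Iio iF, if σ t < σ s then -1 else 1 := by
    rw [hI, ← Finset.image_sdiff _ _ hinj, crossSign, Finset.prod_image hinj.injOn]
    refine Finset.prod_congr rfl fun s hs => ?_
    rw [Finset.prod_image hinj.injOn]
    simp only [Function.comp_apply, he.lt_iff_lt]
    symm
    refine Finset.prod_subset (fun t ht => ?_) (fun t ht ht' => ?_)
    · rw [Finset.mem_Iio] at ht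
      simp [ht]
    · refine if_neg ?_
      simp only [Finset.mem_sdiff, Finset.mem_univ, true_and, Finset.mem_Ico, Finset.mem_Iio,
        Fin.lt_def, Fin.le_def, hiF, hbF] at hs ht ht'
      have := (hσ.val_lt_iff s).mpr hs.2
      have := hσ.val_lt_iff t
      rw [Fin.lt_def]
      omega
  have hL : ((Equiv.Perm.sign σ : ℤ) : k) =
      ∏ s ∈ Finset.Ico iF bF, ∏ t ∈ Finset.Iio iF, if σ t < σ s then 1 else -1 := by
    rw [Equiv.Perm.sign_eq_prod_prod_Iio]
    push_cast
    symm
    rw [← Finset.prod_subset (Finset.subset_univ (Finset.Ico iF bF))]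
    · refine Finset.prod_congr rfl fun s hs => ?_
      simp only [Finset.mem_Ico, Fin.lt_def, Fin.le_def, hiF, hbF] at hs
      have : ∀ t, (((if σ t < σ s then (1 : ℤˣ) else -1 : ℤˣ) : ℤ) : k) =
          if σ t < σ s then 1 else -1 := by
        intro t
        split_ifs <;> simp
      simp only [this]
      refine Finset.prod_subset (fun t ht => ?_) (fun t ht ht' => ?_)
      · simp only [Finset.mem_Iio, Fin.lt_def, hiF] at ht ⊢
        omega
      · simp only [Finset.mem_Iio, Fin.lt_def, hiF] at ht ht'
        exact if_pos (hσ.2.1 t s (by omega) (Fin.lt_def.mpr ht) hs.2)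
    · intro s _ hs
      simp only [Finset.mem_Ico, Fin.lt_def, Fin.le_def, hiF, hbF] at hs
      refine Finset.prod_eq_one fun t ht => ?_
      rw [Finset.mem_Iio] at ht
      have ht' : (t : ℕ) < s := ht
      rw [if_pos]
      · simp
      · by_cases hsi : (s : ℕ) < i
        · exact hσ.1 t s ht hsi
        · rw [hσ.2.2 s (by omega)]
          by_cases htq : (t : ℕ) < i + q
          · have := (hσ.val_lt_iff t).mpr htq
            rw [Fin.lt_def]
            omega
          · rwa [hσ.2.2 t (by omega)]
  have hc : (-1 : k) ^ (i * q) = ∏ s ∈ Finset.Ico iF bF, ∏ t ∈ Finset.Iio iF, (-1 : k) := by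
    simp [hiF, hbF, pow_mul]
  rw [hR, hL, hc, ← Finset.prod_mul_distrib]
  refine Finset.prod_congr rfl fun s _ => ?_
  rw [← Finset.prod_mul_distrib]
  refine Finset.prod_congr rfl fun t _ => ?_
  split_ifs <;> simp

end Shuffle

/-! ### Cochains as labelled functionals; the operations `⋄_i` as contractions of blocks. -/

section Evaluation

variable {k a : Type*} [Field k] [AddCommGroup a] [Module k a] {N n p q : ℕ}

variable (k) in
/-- The element of `k[C_n]` that belongs to the label `r`, when the positions are listed by `e`:
the basis element of the position of `r`, or the sum of all basis elements if there is none. -/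
noncomputable def labelVec (e : Fin n → ℕ) (r : ℕ) : Fin n →₀ k :=
  if ∃ j, e j = r then ∑ j with e j = r, Finsupp.single j 1 else ∑ j, Finsupp.single j 1

theorem labelVec_apply {e : Fin n → ℕ} (he : Function.Injective e) (j : Fin n) :
    labelVec k e (e j) = Finsupp.single j 1 := by
  rw [labelVec, if_pos ⟨j, rfl⟩]
  simp [he.eq_iff, Finset.filter_eq']

theorem labelVec_of_notMem {e : Fin n → ℕ} {r : ℕ} (h : ∀ j, e j ≠ r) :
    labelVec k e r = ∑ j, Finsupp.single j 1 :=
  if_neg fun ⟨j, hj⟩ => h j hj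

/-- The labelled functional of a cochain. -/
noncomputable def eval (f : PLCochain k a n) : Functional a := fun I r x =>
  if h : I.card = n then
    f (labelVec k (I.orderEmbOfFin h) r) fun j => x (I.orderEmbOfFin h j)
  else 0

theorem eval_image (f : PLCochain k a n) {e : Fin n → ℕ} (he : StrictMono e) (r : ℕ)
    (x : ℕ → a) :
    eval f (Finset.univ.image e) r x = f (labelVec k e r) fun j => x (e j) := by
  have hc : (Finset.univ.image e).card = n := by
    rw [Finset.card_image_of_injective _ he.injective, Finset.card_univ, Fintype.card_fin]
  rw [eval, dif_pos hc, ← Finset.orderEmbOfFin_unique hc (by simp) he]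

theorem exists_strictMono_image (I : Finset ℕ) (h : I.card = n) :
    ∃ e : Fin n → ℕ, StrictMono e ∧ Finset.univ.image e = I :=
  ⟨I.orderEmbOfFin h, (I.orderEmbOfFin h).strictMono, Finset.image_orderEmbOfFin_univ I h⟩

theorem eval_of_card_ne (f : PLCochain k a n) {I : Finset ℕ} (h : I.card ≠ n) (r : ℕ)
    (x : ℕ → a) : eval f I r x = 0 := dif_neg h

theorem eval_add (f g : PLCochain k a n) : eval (f + g) = eval f + eval g := by
  funext I r x
  simp only [eval, Pi.add_apply]
  split_ifs <;> simp

theorem eval_smul (c : k) (f : PLCochain k a n) : eval (c • f) = c • eval f := by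
  funext I r x
  simp only [eval, Pi.smul_apply]
  split_ifs <;> simp

theorem update_comp_apply {a : Type*} {e : Fin n → ℕ} (he : Function.Injective e) (x : ℕ → a) (j : Fin n)
    (u : a) : (fun l => Function.update x (e j) u (e l)) =
      Function.update (fun l => x (e l)) j u := by
  funext l
  simp [Function.update_apply, he.eq_iff]

theorem isCochainLike_eval (f : PLCochain k a (n + 1)) : IsCochainLike k n (eval f) where
  eq_zero I r x h := eval_of_card_ne f h r x
  congr_arg I r x y h := by
    by_cases hI : I.card = n + 1
    · obtain ⟨e, he, rfl⟩ := exists_strictMono_image I hI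
      rw [eval_image f he, eval_image f he]
      congr 1
      funext j
      exact h _ (by simp)
    · rw [eval_of_card_ne f hI, eval_of_card_ne f hI]
  eq_sum_label I r x hr := by
    by_cases hI : I.card = n + 1
    · obtain ⟨e, he, rfl⟩ := exists_strictMono_image I hI
      rw [Finset.sum_image he.injective.injOn]
      simp only [eval_image f he, labelVec_apply he.injective]
      rw [labelVec_of_notMem (by simpa using hr), map_sum, _root_.sum_apply]
    · simp only [eval_of_card_ne f hI, Finset.sum_const_zero]
  map_add I r x b hb u v := by
    by_cases hI : I.card = n + 1
    · obtain ⟨e, he, rfl⟩ := exists_strictMono_image I hI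
      obtain ⟨j, -, rfl⟩ := Finset.mem_image.mp hb
      simp only [eval_image f he, update_comp_apply he.injective, MultilinearMap.map_update_add]
    · simp only [eval_of_card_ne f hI, add_zero]
  map_smul I r x b hb c u := by
    by_cases hI : I.card = n + 1
    · obtain ⟨e, he, rfl⟩ := exists_strictMono_image I hI
      obtain ⟨j, -, rfl⟩ := Finset.mem_image.mp hb
      simp only [eval_image f he, update_comp_apply he.injective, MultilinearMap.map_update_smul]
    · simp only [eval_of_card_ne f hI, smul_zero]

/-- A cochain is recovered from its functional on the positions `0, …, n - 1`. -/
theorem eval_injective : Function.Injective (eval (k := k) (a := a) (n := n)) := by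
  intro f g h
  ext r x : 3
  have he : StrictMono (fun j : Fin n => (j : ℕ)) := fun _ _ h => h
  have := congrFun (congrFun (congrFun h (Finset.univ.image fun j : Fin n => (j : ℕ))) r)
    fun s => if hs : s < n then x ⟨s, hs⟩ else 0
  rw [eval_image f he, eval_image g he, labelVec_apply he.injective] at this
  simpa using this

/-- The positions of the boxes, when the position of a box is that of its last entry. -/
def outerPos (e : Fin N → ℕ) (hN : N = p + q + 1) (i : Fin (p + 1)) (σ : Equiv.Perm (Fin N))
    (l : Fin (p + 1)) : ℕ :=
  if (l : ℕ) < i then e (σ ⟨l, by omega⟩) else e (σ ⟨l + q, by omega⟩)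

/-- The positions of the entries of box `i`. -/
def innerPos (e : Fin N → ℕ) (hN : N = p + q + 1) (i : Fin (p + 1)) (σ : Equiv.Perm (Fin N))
    (j : Fin (q + 1)) : ℕ :=
  e (σ ⟨i + j, by omega⟩)

/-- The positions of all entries of box `i` but the last. -/
def blockOf (e : Fin N → ℕ) (hN : N = p + q + 1) (i : Fin (p + 1)) (σ : Equiv.Perm (Fin N)) :
    Finset ℕ :=
  (Finset.Ico (⟨i, by omega⟩ : Fin N) ⟨i + q, by omega⟩).image (e ∘ σ)

variable {e : Fin N → ℕ} (he : StrictMono e) (hN : N = p + q + 1) {i : Fin (p + 1)}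
  {σ : Equiv.Perm (Fin N)} (hσ : IsShuffle i q σ)

include he hσ

theorem strictMono_outerPos : StrictMono (outerPos e hN i σ) := by
  intro l l' hl
  have hl' : (l : ℕ) < l' := hl
  unfold outerPos
  split_ifs with h₁ h₂ h₂
  · exact he (hσ.1 _ _ hl h₂)
  · apply he
    rw [hσ.2.2 ⟨l' + q, _⟩ (by simp; omega), Fin.lt_def]
    have := (hσ.val_lt_iff ⟨l, by omega⟩).mpr (by simp; omega)
    simp only
    omega
  · omega
  · apply he
    rw [hσ.2.2 ⟨l' + q, _⟩ (by simp; omega), hσ.2.2 ⟨l + q, _⟩ (by simp; omega), Fin.lt_def]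
    simp only
    omega

theorem strictMono_innerPos : StrictMono (innerPos e hN i σ) := by
  intro j j' hj
  have hj' : (j : ℕ) < j' := hj
  apply he
  by_cases h : (j' : ℕ) < q
  · exact hσ.2.1 _ _ (by simp) (by rw [Fin.lt_def]; simp only; omega) (by simp only; omega)
  · rw [hσ.2.2 ⟨i + j', _⟩ (by simp; omega), Fin.lt_def]
    have := (hσ.val_lt_iff ⟨i + j, by omega⟩).mpr (by simp; omega)
    simp only
    omega

/-- The box and position maps `R` and `S` are what the label conventions yield when the contracted
box sits at the position of its last entry, which `σ` fixes. -/
theorem compTerm_eval (f : PLCochain k a (p + 1)) (g : PLCochain k a (q + 1)) (s : Fin N)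
    (x : ℕ → a) :
    compTerm (eval f) (eval g) (Finset.univ.image e) (e s) x (e ⟨i + q, by omega⟩)
        (blockOf e hN i σ) =
      f (Finsupp.single (R hN i σ s) 1)
        (insertArgs hN i (g (S k i σ s)) fun t => x (e (σ t))) := by
  have ho := strictMono_outerPos he hN hσ
  have hi := strictMono_innerPos he hN hσ
  have hinj : Function.Injective (e ∘ σ) := he.injective.comp σ.injective
  have hlast : σ ⟨i + q, by omega⟩ = ⟨i + q, by omega⟩ := hσ.2.2 _ (by simp)
  have hmem : ∀ t : Fin N, e (σ t) ∈ blockOf e hN i σ ↔ (i : ℕ) ≤ t ∧ (t : ℕ) < i + q := by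
    intro t
    rw [blockOf, ← Function.comp_apply (f := e), hinj.mem_finset_image]
    simp [Fin.le_def, Fin.lt_def]
  have hib : innerPos e hN i σ ⟨q, by omega⟩ = e ⟨i + q, by omega⟩ := by
    simp only [innerPos, hlast]
  have hob : outerPos e hN i σ i = e ⟨i + q, by omega⟩ := by
    simp only [outerPos, lt_irrefl, if_false, hlast]
  have hI : insert (e ⟨i + q, by omega⟩) (blockOf e hN i σ) =
      Finset.univ.image (innerPos e hN i σ) := by
    ext u
    simp only [Finset.mem_insert, Finset.mem_image, Finset.mem_univ, true_and]
    constructor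
    · rintro (rfl | hu)
      · exact ⟨_, hib⟩
      · obtain ⟨t, ht, rfl⟩ := Finset.mem_image.mp hu
        simp only [Finset.mem_Ico, Fin.le_def, Fin.lt_def] at ht
        refine ⟨⟨t - i, by omega⟩, ?_⟩
        simp only [innerPos, Function.comp_apply]
        congr 3
        omega
    · rintro ⟨j, rfl⟩
      by_cases hj : (j : ℕ) < q
      · right
        rw [innerPos, hmem]
        simp only
        omega
      · left
        have : j = ⟨q, by omega⟩ := Fin.ext (by simp only; omega)
        rw [this, hib]
  have hO : Finset.univ.image e \ blockOf e hN i σ = Finset.univ.image (outerPos e hN i σ) := by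
    ext u
    simp only [Finset.mem_sdiff, Finset.mem_image, Finset.mem_univ, true_and]
    constructor
    · rintro ⟨⟨t', rfl⟩, ht⟩
      obtain ⟨t, rfl⟩ := σ.surjective t'
      rw [hmem] at ht
      by_cases h : (t : ℕ) < i
      · exact ⟨⟨t, by omega⟩, by simp [outerPos, h]⟩
      · refine ⟨⟨t - q, by omega⟩, ?_⟩
        rw [outerPos, if_neg (by simp only; omega)]
        congr 3
        simp only
        omega
    · rintro ⟨l, rfl⟩
      unfold outerPos
      split_ifs with h
      · refine ⟨⟨_, rfl⟩, ?_⟩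
        rw [hmem]
        simp only
        omega
      · refine ⟨⟨_, rfl⟩, ?_⟩
        rw [hmem]
        simp only
        omega
  rw [compTerm, hI, hO, eval_image f ho, eval_image g hi]
  obtain ⟨t, rfl⟩ := σ.surjective s
  have hR : labelVec k (outerPos e hN i σ)
      (if e (σ t) ∈ blockOf e hN i σ then e ⟨i + q, by omega⟩ else e (σ t)) =
      Finsupp.single (R hN i σ (σ t)) 1 := by
    rw [← labelVec_apply ho.injective]
    congr 1
    simp only [R, Equiv.symm_apply_apply, hmem, box]
    by_cases h₁ : (t : ℕ) < i
    · rw [if_neg (by omega), dif_pos h₁]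
      simp [outerPos, h₁]
    · rw [dif_neg h₁]
      by_cases h₂ : (t : ℕ) ≤ i + q
      · rw [if_pos h₂, hob]
        split_ifs with h
        · rfl
        · rw [← hlast]
          congr 2
          apply Fin.ext
          simp only
          omega
      · rw [if_neg h₂, if_neg (by omega), outerPos, if_neg (by simp only; omega)]
        congr 2
        apply Fin.ext
        simp only
        omega
  have hS : labelVec k (innerPos e hN i σ) (e (σ t)) = S k i σ (σ t) := by
    unfold S
    split_ifs with h
    · rw [← labelVec_apply hi.injective]
      simp only [Equiv.symm_apply_apply] at h
      simp only [innerPos, Equiv.symm_apply_apply]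
      congr 3
      apply Fin.ext
      simp only
      omega
    · apply labelVec_of_notMem
      intro j hj
      have := congrArg Fin.val (hinj hj)
      simp only [Equiv.symm_apply_apply] at h this
      omega
  rw [hR, hS]
  congr 1
  rw [← hob, update_comp_apply ho.injective]
  funext l
  unfold insertArgs
  by_cases hl : l = i
  · subst hl
    simp only [Function.update_self]
    rfl
  · rw [Function.update_of_ne hl, Function.update_of_ne hl]
    unfold outerPos
    split_ifs <;> rfl

omit hσ

theorem comp_eval_apply (f : PLCochain k a (p + 1)) (g : PLCochain k a (q + 1)) (s : Fin N)
    (x : ℕ → a) :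
    comp k (eval f) (eval g) (Finset.univ.image e) (e s) x =
      (∑ i : Fin (p + 1), (-1 : k) ^ ((i : ℕ) * q) • diamond hN i f g) (Finsupp.single s 1)
        fun t => x (e t) := by
  have hf := isCochainLike_eval f
  have hg := isCochainLike_eval g
  have hR : (∑ i : Fin (p + 1), (-1 : k) ^ ((i : ℕ) * q) • diamond hN i f g)
      (Finsupp.single s 1) (fun t => x (e t)) =
      ∑ w ∈ (Finset.univ : Finset (Fin (p + 1))).sigma fun i =>
        Finset.univ.filter fun σ : Equiv.Perm (Fin N) => IsShuffle i q σ,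
        ((-1 : k) ^ ((w.1 : ℕ) * q) * ((Equiv.Perm.sign w.2 : ℤ) : k)) •
          f (Finsupp.single (R hN w.1 w.2 s) 1)
            (insertArgs hN w.1 (g (S k w.1 w.2 s)) fun t => x (e (w.2 t))) := by
    rw [Finset.sum_sigma]
    simp only [LinearMap.sum_apply, LinearMap.smul_apply, _root_.sum_apply,
      _root_.smul_apply, diamond, Finsupp.linearCombination_single, one_smul, mul_smul,
      Finset.smul_sum]
    rfl
  rw [hR, comp, ← Finset.sum_filter_of_ne (p := fun z => z.2.card = q)]
  swap
  · intro z hz h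
    by_contra hc
    exact h (by rw [compTerm_eq_zero hf hg _ _ hz hc, smul_zero])
  symm
  -- A box number and a shuffle correspond to a block with `q` elements below its top.
  refine Finset.sum_bij (fun w _ => (e ⟨w.1 + q, by omega⟩, blockOf e hN w.1 w.2))
    ?_ ?_ ?_ ?_
  · rintro ⟨i, σ⟩ hw
    simp only [Finset.mem_sigma, Finset.mem_univ, Finset.mem_filter, true_and] at hw
    rw [Finset.mem_filter, mem_blocks]
    refine ⟨⟨by simp, ?_, ?_⟩, ?_⟩
    · intro u hu
      obtain ⟨t, -, rfl⟩ := Finset.mem_image.mp hu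
      simp
    · intro u hu
      obtain ⟨t, ht, rfl⟩ := Finset.mem_image.mp hu
      simp only [Finset.mem_Ico, Fin.lt_def] at ht
      exact he (Fin.lt_def.mpr ((hw.val_lt_iff t).mpr ht.2))
    · simp only [blockOf]
      rw [Finset.card_image_of_injective _ (he.injective.comp σ.injective), Fin.card_Ico]
      simp
  · rintro ⟨i, σ⟩ hw ⟨i', σ'⟩ hw' h
    simp only [Finset.mem_sigma, Finset.mem_univ, Finset.mem_filter, true_and] at hw hw'
    simp only [Prod.mk.injEq, he.injective.eq_iff, Fin.mk.injEq, add_left_inj] at h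
    obtain ⟨hi, hb⟩ := h
    obtain rfl := Fin.ext hi
    simp only [blockOf, ← Finset.image_image] at hb
    rw [hw.eq_of_image_eq hw' (by omega) (Finset.image_injective he.injective hb)]
  · rintro ⟨b', A'⟩ hz
    rw [Finset.mem_filter, mem_blocks] at hz
    obtain ⟨⟨hb, hA, hlt⟩, hc⟩ := hz
    obtain ⟨b, -, rfl⟩ := Finset.mem_image.mp hb
    obtain ⟨A, -, rfl⟩ := Finset.subset_image_iff.mp hA
    simp only [Finset.card_image_of_injective _ he.injective] at hc
    subst hc
    obtain ⟨hle, σ, hσ, hσA⟩ := exists_isShuffle A b fun t ht =>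
      he.lt_iff_lt.mp (hlt _ (Finset.mem_image_of_mem e ht))
    -- The box ends at index `b` and has `A.card` earlier entries, so it starts at `b - A.card`.
    refine ⟨⟨⟨b - A.card, by omega⟩, σ⟩, by simpa using hσ, ?_⟩
    have hb : (⟨b - A.card + A.card, by omega⟩ : Fin N) = b := Fin.ext (by simp only; omega)
    simp only [blockOf, hb, ← Finset.image_image, hσA]
  · rintro ⟨i, σ⟩ hw
    simp only [Finset.mem_sigma, Finset.mem_univ, Finset.mem_filter, true_and] at hw
    simp only
    rw [compTerm_eval he hN hw, hw.sign_eq k (by omega) he]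
    rfl

omit he

/-- The signed sum of the operations `⋄_i` is the composition of functionals. -/
theorem eval_sum_diamond (f : PLCochain k a (p + 1)) (g : PLCochain k a (q + 1)) :
    eval (∑ i : Fin (p + 1), (-1 : k) ^ ((i : ℕ) * q) • diamond hN i f g) =
      comp k (eval f) (eval g) := by
  subst hN
  have hf := isCochainLike_eval f
  have hg := isCochainLike_eval g
  funext I r x
  by_cases hI : I.card = p + q + 1
  · obtain ⟨e, he, rfl⟩ := exists_strictMono_image I hI
    have key : ∀ s, eval (∑ i : Fin (p + 1), (-1 : k) ^ ((i : ℕ) * q) • diamond rfl i f g)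
        (Finset.univ.image e) (e s) x =
          comp k (eval f) (eval g) (Finset.univ.image e) (e s) x := by
      intro s
      rw [eval_image _ he, labelVec_apply he.injective, comp_eval_apply he rfl]
    by_cases hr : r ∈ Finset.univ.image e
    · obtain ⟨s, -, rfl⟩ := Finset.mem_image.mp hr
      exact key s
    · rw [comp_eq_sum_label hf hg hr, (isCochainLike_eval _).eq_sum_label _ _ _ hr]
      refine Finset.sum_congr rfl fun u hu => ?_
      obtain ⟨s, -, rfl⟩ := Finset.mem_image.mp hu
      exact key s
  · rw [eval_of_card_ne _ hI]
    symm
    -- On a set of the wrong size, each block has the wrong size for `g` or leaves the wrong number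
    -- of positions for `f`.
    refine Finset.sum_eq_zero fun z hz => ?_
    by_cases hc : z.2.card = q
    · rw [compTerm, hf.eq_zero, smul_zero]
      rw [Finset.card_sdiff_of_subset (mem_blocks.mp hz).2.1]
      omega
    · rw [compTerm_eq_zero hf hg r x hz hc, smul_zero]

end Evaluation

end PLCochain

namespace PLCochain

variable {k a : Type*} [Field k] [AddCommGroup a] [Module k a]

/-! ### The graded commutator and the graded Lie axioms. -/

section Bracket

theorem comp_sub_smul_left (c : k) (F F' G : Functional a) :
    comp k (F - c • F') G = comp k F G - c • comp k F' G := by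
  rw [sub_eq_add_neg, ← neg_smul, comp_add_left, comp_smul_left, neg_smul, ← sub_eq_add_neg]

theorem comp_sub_smul_right {p : ℕ} {F : Functional a} (hF : IsCochainLike k p F) (c : k)
    (G G' : Functional a) : comp k F (G - c • G') = comp k F G - c • comp k F G' := by
  rw [sub_eq_add_neg, ← neg_smul, comp_add_right hF, comp_smul_right hF, neg_smul,
    ← sub_eq_add_neg]

theorem eval_sub_smul {n : ℕ} (f g : PLCochain k a n) (c : k) :
    eval (f - c • g) = eval f - c • eval g := by
  funext I r x
  simp only [eval, Pi.sub_apply, Pi.smul_apply]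
  split_ifs <;> simp

theorem eval_neg {n : ℕ} (f : PLCochain k a n) : eval (-f) = -eval f := by
  funext I r x
  simp only [eval, Pi.neg_apply]
  split_ifs <;> simp

theorem eval_bracket {p q : ℕ} (f : PLCochain k a (p + 1)) (g : PLCochain k a (q + 1)) :
    eval (bracket k a p q f g) =
      comp k (eval f) (eval g) - (-1 : k) ^ (p * q) • comp k (eval g) (eval f) := by
  have h : bracket k a p q f g = bracketFun f g := rfl
  rw [h, bracketFun, eval_sub_smul, eval_sum_diamond, eval_sum_diamond]

/-- Moves a cochain along an equality of degrees without casts in later statements: the functional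
does not mention the degree. -/
theorem exists_lof_eq {m n : ℕ} (h : m = n) (u : PLCochain k a (m + 1)) :
    ∃ v : PLCochain k a (n + 1),
      DirectSum.lof k ℕ (fun p => PLCochain k a (p + 1)) m u =
        DirectSum.lof k ℕ (fun p => PLCochain k a (p + 1)) n v ∧ eval v = eval u := by
  subst h
  exact ⟨u, rfl, rfl⟩

/-- The passage from pre-Lie to Jacobi, as linear algebra in the twelve threefold products: the `uᵢ`
are bracketed to the left, the `vᵢ` to the right, and `α`, `β`, `γ` are the signs of the three pairs
of degrees. -/
theorem jacobi_of_preLie {M : Type*} [AddCommGroup M] [Module k M] {α β γ : k}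
    (hα : α = 1 ∨ α = -1) (hβ : β = 1 ∨ β = -1) (hγ : γ = 1 ∨ γ = -1)
    {u₁ u₂ u₃ u₄ u₅ u₆ v₁ v₂ v₃ v₄ v₅ v₆ : M}
    (h₁ : u₁ - v₁ = γ • (u₂ - v₂)) (h₂ : u₃ - v₃ = β • (u₄ - v₄))
    (h₃ : u₅ - v₅ = α • (u₆ - v₆)) :
    v₁ - γ • v₂ - (α * β) • (u₄ - γ • u₆) =
      u₁ - α • u₃ - (β * γ) • (v₅ - α • v₆) +
        α • (v₃ - β • v₄ - (α * γ) • (u₂ - β • u₅)) := by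
  rw [sub_eq_iff_eq_add] at h₁ h₂ h₃
  rw [h₁, h₂, h₃]
  rcases hα with rfl | rfl <;> rcases hβ with rfl | rfl <;> rcases hγ with rfl | rfl <;> module

theorem eval_bracket_skew {p q : ℕ} (f : PLCochain k a (p + 1)) (g : PLCochain k a (q + 1)) :
    eval (bracket k a p q f g) = -((-1 : k) ^ (p * q) • eval (bracket k a q p g f)) := by
  rw [eval_bracket, eval_bracket, mul_comm q p]
  generalize comp k (eval f) (eval g) = u, comp k (eval g) (eval f) = v
  rcases neg_one_pow_eq_or k (p * q) with h | h <;> rw [h] <;> module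

theorem eval_bracket_jacobi {p q r : ℕ} (f : PLCochain k a (p + 1)) (g : PLCochain k a (q + 1))
    (h : PLCochain k a (r + 1)) :
    eval (bracket k a p (q + r) f (bracket k a q r g h)) =
      eval (bracket k a (p + q) r (bracket k a p q f g) h) +
        (-1 : k) ^ (p * q) • eval (bracket k a q (p + r) g (bracket k a p r f h)) := by
  have hf := isCochainLike_eval f
  have hg := isCochainLike_eval g
  have hh := isCochainLike_eval h
  rw [eval_bracket f, eval_bracket g h, eval_bracket _ h, eval_bracket f g, eval_bracket g,
    eval_bracket f h]
  simp only [comp_sub_smul_left, comp_sub_smul_right hf, comp_sub_smul_right hg,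
    comp_sub_smul_right hh]
  rw [mul_add p q r, add_mul p q r, mul_add q p r, pow_add, pow_add, pow_add, mul_comm q p]
  exact jacobi_of_preLie (neg_one_pow_eq_or k (p * q)) (neg_one_pow_eq_or k (p * r))
    (neg_one_pow_eq_or k (q * r)) (comp_preLie hf hg hh) (comp_preLie hg hf hh)
    (comp_preLie hh hf hg)

theorem isGradedLieBracket_bracket :
    IsGradedLieBracket (L := fun p => PLCochain k a (p + 1)) (bracket k a) where
  skew p q f g := by
    obtain ⟨v, hv, hev⟩ := exists_lof_eq (add_comm q p) (bracket k a q p g f)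
    have h : bracket k a p q f g = -((-1 : k) ^ (p * q) • v) := by
      apply eval_injective
      rw [eval_neg, eval_smul, hev, eval_bracket_skew]
    rw [hv, h, map_neg, map_smul]
  jacobi p q r f g h := by
    obtain ⟨v, hv, hev⟩ := exists_lof_eq (add_assoc p q r)
      (bracket k a (p + q) r (bracket k a p q f g) h)
    obtain ⟨w, hw, hew⟩ := exists_lof_eq (add_left_comm q p r)
      (bracket k a q (p + r) g (bracket k a p r f h))
    have e : bracket k a p (q + r) f (bracket k a q r g h) = v + (-1 : k) ^ (p * q) • w := by
      apply eval_injective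
      rw [eval_add, eval_smul, hev, hew, eval_bracket_jacobi]
    exact (congrArg _ e).trans (((map_add _ _ _).trans
      (congrArg _ (map_smul _ _ _))).trans (by rw [← hv, ← hw]))

end Bracket

/-! ### Binary cochains and Maurer–Cartan elements. -/

section MaurerCartan

/-- The bilinear operation that belongs to the symbol `[r + 1]` of a binary cochain. -/
noncomputable def operation (π : PLCochain k a 2) (r : Fin 2) : a →ₗ[k] a →ₗ[k] a :=
  have h₀ (x y : a) : ![x, y] = Function.update ![0, y] 0 x := by
    funext i; fin_cases i <;> rfl
  have h₁ (x y : a) : ![x, y] = Function.update ![x, 0] 1 y := by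
    funext i; fin_cases i <;> rfl
  LinearMap.mk₂ k (fun x y => π (Finsupp.single r 1) ![x, y])
    (fun x x' y => by
      rw [h₀ (x + x') y, h₀ x y, h₀ x' y, MultilinearMap.map_update_add])
    (fun c x y => by
      rw [h₀ (c • x) y, h₀ x y, MultilinearMap.map_update_smul])
    (fun x y y' => by
      rw [h₁ x (y + y'), h₁ x y, h₁ x y', MultilinearMap.map_update_add])
    (fun c x y => by
      rw [h₁ x (c • y), h₁ x y, MultilinearMap.map_update_smul])

theorem operation_apply (π : PLCochain k a 2) (r : Fin 2) (x y : a) :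
    operation π r x y = π (Finsupp.single r 1) ![x, y] := rfl

/-- The binary cochain with given operations. -/
noncomputable def ofOperations (B : Fin 2 → a →ₗ[k] a →ₗ[k] a) : PLCochain k a 2 :=
  Finsupp.linearCombination k fun r =>
    MultilinearMap.mk' (fun x => B r (x 0) (x 1))
      (by intro x i c d; fin_cases i <;> simp)
      (by intro x i c d; fin_cases i <;> simp)

theorem operation_ofOperations (B : Fin 2 → a →ₗ[k] a →ₗ[k] a) (r : Fin 2) :
    operation (ofOperations B) r = B r := by
  ext x y
  simp [operation_apply, ofOperations]

theorem ofOperations_operation (π : PLCochain k a 2) : ofOperations (operation π) = π := by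
  ext r x : 3
  simp only [ofOperations, LinearMap.coe_comp, Function.comp_apply, Finsupp.lsingle_apply,
    Finsupp.linearCombination_single, one_smul, MultilinearMap.mk'_apply, operation_apply]
  congr 1
  funext i
  fin_cases i <;> rfl

theorem eval_pair (π : PLCochain k a 2) {u v : ℕ} (h : u < v) (r : ℕ) (x : ℕ → a) :
    eval π {u, v} r x = if r = u then operation π 0 (x u) (x v)
      else if r = v then operation π 1 (x u) (x v)
      else operation π 0 (x u) (x v) + operation π 1 (x u) (x v) := by
  have he : StrictMono ![u, v] := by
    intro i j hij
    fin_cases i <;> fin_cases j <;> simp_all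
  have hI : ({u, v} : Finset ℕ) = Finset.univ.image ![u, v] := by
    ext t
    simp [Fin.exists_fin_two, eq_comm]
  have hx : (fun j => x (![u, v] j)) = ![x u, x v] := by
    funext j
    fin_cases j <;> rfl
  rw [hI, eval_image π he, hx]
  split_ifs with h₁ h₂
  · subst h₁
    exact congrArg (fun w => π w ![x r, x v]) (labelVec_apply (k := k) he.injective 0)
  · subst h₂
    exact congrArg (fun w => π w ![x u, x r]) (labelVec_apply (k := k) he.injective 1)
  · rw [labelVec_of_notMem, Fin.sum_univ_two, map_add]
    · rfl
    · intro j
      fin_cases j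
      · exact fun e => h₁ e.symm
      · exact fun e => h₂ e.symm

theorem eq_zero_iff_eval {n : ℕ} (f : PLCochain k a n) :
    f = 0 ↔ ∀ r < n, ∀ x : ℕ → a, eval f (Finset.range n) r x = 0 := by
  have hI : Finset.univ.image (fun j : Fin n => (j : ℕ)) = Finset.range n := by
    ext t
    simp only [Finset.mem_image, Finset.mem_univ, true_and, Finset.mem_range]
    exact ⟨fun ⟨j, hj⟩ => hj ▸ j.2, fun h => ⟨⟨t, h⟩, rfl⟩⟩
  have he : StrictMono (fun j : Fin n => (j : ℕ)) := fun _ _ h => h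
  constructor
  · rintro rfl r - x
    rw [← hI, eval_image _ he]
    rfl
  · intro h
    ext r x : 3
    have := h r r.2 fun s => if hs : s < n then x ⟨s, hs⟩ else 0
    rw [← hI, eval_image f he, labelVec_apply he.injective] at this
    simpa using this

theorem comp_eval_range_three (π : PLCochain k a 2) (r : ℕ) (x : ℕ → a) :
    comp k (eval π) (eval π) (Finset.range 3) r x =
      compTerm (eval π) (eval π) (Finset.range 3) r x 1 {0} +
        compTerm (eval π) (eval π) (Finset.range 3) r x 2 {0} -
          compTerm (eval π) (eval π) (Finset.range 3) r x 2 {1} := by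
  have hπ := isCochainLike_eval π
  -- Only singletons `A` matter for a binary `π`. The block with `A = {1}` gets the sign `-1`,
  -- because `0` stays behind and is smaller.
  have hb : (blocks (Finset.range 3)).filter (fun z => z.2.card = 1) =
      {(1, {0}), (2, {0}), (2, {1})} := by decide
  rw [comp, ← Finset.sum_filter_of_ne (p := fun z => z.2.card = 1), hb]
  · rw [Finset.sum_insert (by decide), Finset.sum_insert (by decide), Finset.sum_singleton]
    have h₀ : Finset.range 3 \ {0} = {1, 2} := by decide
    have h₁ : Finset.range 3 \ {1} = {0, 2} := by decide
    simp only [h₀, h₁, crossSign]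
    simp
    abel
  · intro z hz h
    by_contra hc
    exact h (by rw [compTerm_eq_zero hπ hπ _ _ hz hc, smul_zero])

/-- The labels `0`, `1`, `2` in `π ∘ π = 0` give the three axioms in this order. -/
theorem isMaurerCartan_iff [CharZero k] (π : PLCochain k a 2) :
    IsMaurerCartan (L := fun p => PLCochain k a (p + 1)) (bracket k a) π ↔
      (∀ x y z : a, operation π 0 x (operation π 0 y z + operation π 1 y z) =
        operation π 0 (operation π 0 x y) z + operation π 1 y (operation π 0 x z)) ∧
      (∀ x y z : a, operation π 1 x (operation π 0 y z) =
        operation π 0 (operation π 1 x y) z +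
          operation π 0 y (operation π 0 x z + operation π 1 x z)) ∧
      (∀ x y z : a, operation π 1 x (operation π 1 y z) =
        operation π 1 (operation π 0 x y + operation π 1 x y) z +
          operation π 1 y (operation π 1 x z)) := by
  have h₀ : IsMaurerCartan (L := fun p => PLCochain k a (p + 1)) (bracket k a) π ↔
      ∀ r < 3, ∀ x : ℕ → a, comp k (eval π) (eval π) (Finset.range 3) r x = 0 := by
    refine (eq_zero_iff_eval (n := 3) (bracket k a 1 1 π π)).trans ?_
    refine forall_congr' fun r => forall_congr' fun _ => forall_congr' fun x => ?_
    -- In degree one the commutator sign is `-1`, so the two products add up; characteristic zero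
    -- then allows dividing by `2`.
    have : eval (bracket k a 1 1 π π) (Finset.range 3) r x =
        (2 : k) • comp k (eval π) (eval π) (Finset.range 3) r x := by
      rw [eval_bracket]
      simp only [Pi.sub_apply, Pi.smul_apply]
      module
    rw [this, smul_eq_zero, or_iff_right two_ne_zero]
  have e₀ : Finset.range 3 \ {0} = {1, 2} := by decide
  have e₁ : Finset.range 3 \ {1} = {0, 2} := by decide
  have e₂ : (insert 1 {0} : Finset ℕ) = {0, 1} := by decide
  have e₃ : (insert 2 {0} : Finset ℕ) = {0, 2} := by decide
  have e₄ : (insert 2 {1} : Finset ℕ) = {1, 2} := by decide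
  have hr : ∀ P : ℕ → Prop, (∀ r < 3, P r) ↔ P 0 ∧ P 1 ∧ P 2 := by
    intro P
    refine ⟨fun h => ⟨h 0 (by omega), h 1 (by omega), h 2 (by omega)⟩, ?_⟩
    rintro ⟨h, h', h''⟩ r hr
    interval_cases r <;> assumption
  have hx : ∀ Q : a → a → a → Prop,
      (∀ x : ℕ → a, Q (x 0) (x 1) (x 2)) ↔ ∀ x y z, Q x y z := fun Q =>
    ⟨fun h x y z => h fun n => if n = 0 then x else if n = 1 then y else z,
      fun h x => h _ _ _⟩
  have p₀₁ := fun r x => eval_pair π (u := 0) (v := 1) (by omega) r x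
  have p₀₂ := fun r x => eval_pair π (u := 0) (v := 2) (by omega) r x
  have p₁₂ := fun r x => eval_pair π (u := 1) (v := 2) (by omega) r x
  rw [h₀, hr, ← hx, ← hx, ← hx]
  simp only [comp_eval_range_three, compTerm, e₀, e₁, e₂, e₃, e₄, p₀₁, p₀₂, p₁₂]
  refine and_congr ?_ (and_congr ?_ ?_) <;> refine forall_congr' fun x => ?_ <;>
    simp only [Finset.mem_singleton, map_add, LinearMap.add_apply, OfNat.ofNat_ne_zero,
        OfNat.zero_ne_ofNat, Function.update_self, sub_eq_zero] <;> simp <;> exact eq_comm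

end MaurerCartan

end PLCochain

open PLCochain in
theorem theorem3p1 (k a : Type*) [Field k] [CharZero k] [AddCommGroup a] [Module k a] :
    IsGradedLieBracket (L := fun p => PLCochain k a (p + 1)) (PLCochain.bracket k a) ∧
    ∃ Φ : PreLeibniz k a ≃
        {π : PLCochain k a 2 //
          IsMaurerCartan (L := fun p => PLCochain k a (p + 1)) (PLCochain.bracket k a) π},
      ∀ (P : PreLeibniz k a) (x y : a),
        (Φ P).1 (Finsupp.single 0 1) ![x, y] = P.left x y ∧
        (Φ P).1 (Finsupp.single 1 1) ![x, y] = P.right x y := by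
  refine ⟨isGradedLieBracket_bracket, ?_⟩
  have h₀ : ∀ P : PreLeibniz k a,
      operation (ofOperations ![P.left, P.right]) 0 = P.left := fun P =>
    operation_ofOperations _ 0
  have h₁ : ∀ P : PreLeibniz k a,
      operation (ofOperations ![P.left, P.right]) 1 = P.right := fun P =>
    operation_ofOperations _ 1
  refine ⟨{
    toFun P := ⟨ofOperations ![P.left, P.right], by
      rw [isMaurerCartan_iff, h₀, h₁]
      exact ⟨P.left_left, P.right_left, P.right_right⟩⟩
    invFun π :=
      { left := operation π.1 0
        right := operation π.1 1
        left_left := ((isMaurerCartan_iff π.1).mp π.2).1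
        right_left := ((isMaurerCartan_iff π.1).mp π.2).2.1
        right_right := ((isMaurerCartan_iff π.1).mp π.2).2.2 }
    left_inv P := PreLeibniz.ext (h₀ P) (h₁ P)
    right_inv π := by
      apply Subtype.ext
      have : ![operation π.1 0, operation π.1 1] = operation π.1 := by
        funext r
        fin_cases r <;> rfl
      simp only [this, ofOperations_operation] }, fun P x y => ⟨?_, ?_⟩⟩
  · exact LinearMap.congr_fun₂ (h₀ P) x y
  · exact LinearMap.congr_fun₂ (h₁ P) x y
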